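/- Let $\Omega$ be a hyper-Stonian space, i.e. a compact Hausdorff space in which the closure of every open set is open and such that for every nonzero $f\ge 0$ in $C(\Omega,\mathbb R)$ there is a finite positive normal Radon measure $\mu$ on $\Omega$ with $\int f\,d\mu>0$ ($\mu$ is normal if $\int\sup_i f_i\,d\mu=\sup_i\int f_i\,d\mu$ for every increasing net $(f_i)$ in $C(\Omega,\mathbb R)$ having a supremum in $C(\Omega,\mathbb R)$). Write $C(\Omega)=C(\Omega,\mathbb C)$. Let $X$ be a $C(\Omega)$-convex Banach module, i.e. a complex Banach space that is a unital $C(\Omega)$-module with $\|f\cdot x\|\le\|f\|\,\|x\|$, whose closed unit ball is closed under the combinations $f\cdot x+g\cdot y$ with $f,g\in C(\Omega)$, $f,g\ge 0$, $f+g=1$. For $x\in X$ and $\omega\in\Omega$ let $\|x(\omega)\|$ be the norm of the class of $x$ in the quotient of $X$ by the closed linear span of $\{f\cdot y: y\in X,\ f\in C(\Omega),\ f(\omega)=0\}$ (the fibre at $\omega$ of the Banach bundle associated with $X$), and put $$\|x\|_e=\inf\Big\{\sup_{\omega\in\Delta}\|x(\omega)\| : \Delta\subseteq\Omega\text{ open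 and dense}\Big\}.$$ Let $X_{\rm ess}$ be the completion of $(X/N,\|\cdot\|_e)$, where $N=\{x\in X:\|x\|_e=0\}$. For a normed $C(\Omega)$-module $Y$ let $Y^s$ be the normed $C(\Omega)$-module of all continuous $C(\Omega)$-module maps $Y\to C(\Omega)$, with the operator norm, and let $\kappa_X:X\to X^{ss}=(X^s)^s$ be $\kappa_X(x)(\varphi)=\varphi(x)$; $X$ is called regular if $\kappa_X$ is an isometry. An (F)-Banach bundle over $\Omega$ is a topological space $E$ with a continuous open surjection $p:E\to\Omega$ and a complex Banach space structure on each fibre $E_\omega=p^{-1}(\omega)$ such that addition $\{(a,b)\in E\times E:p(a)=p(b)\}\to E$, scalar multiplication $\mathbb C\times E\to E$ and the norm $E\to\mathbb R$ are continuous, and for each $\omega\in\Omega$ the sets $\{e\in E:p(e)\in U,\ \|e\|<\varepsilon\}$ ($U$ a neighbourhood of $\omega$, $\varepsilon>0$) form a neighbourhood basis at the zero vector of $E_\omega$. Let $\Gamma(E)$ be the $C(\Omega)$-module of continuous sections of $E$, with pointwise operations and the supremum norm. Then the following are equivalent: (i) $X=X_{\rm ess}$, i.e. the canonical map $X\to X_{\rm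 ess}$ is an isometry of $X$ onto $X_{\rm ess}$; (ii) $X$ is regular; (iii) $X=\Gamma(E)$ for an (F)-Banach bundle $E$ over $\Omega$, i.e. there is an isometric isomorphism of $C(\Omega)$-modules between $X$ and $\Gamma(E)$. -/

import Mathlib

open MeasureTheory

universe u v

namespace BanachModule

noncomputable section

/-! ### Hyper-Stonian spaces -/

section HyperStonian

variable {Ω : Type u} [TopologicalSpace Ω] [CompactSpace Ω] [MeasurableSpace Ω]

/-- A measure is normal if integration against it preserves suprema (computed in the ordered
space `C(Ω, ℝ)`) of nonempty upward directed families of continuous functions. -/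
def IsNormalMeasure (μ : Measure Ω) : Prop :=
  ∀ (D : Set C(Ω, ℝ)) (f : C(Ω, ℝ)), D.Nonempty → DirectedOn (· ≤ ·) D → IsLUB D f →
    IsLUB ((fun g : C(Ω, ℝ) => ∫ ω, g ω ∂μ) '' D) (∫ ω, f ω ∂μ)

variable (Ω) in
/-- A compact Hausdorff space is hyper-Stonian if it is Stonian (extremally disconnected) and has
sufficiently many positive normal Radon measures. -/
structure IsHyperStonian : Prop where
  stonian : ExtremallyDisconnected Ω
  exists_normal : ∀ f : C(Ω, ℝ), 0 ≤ f → f ≠ 0 →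
    ∃ μ : Measure Ω, IsFiniteMeasure μ ∧ μ.Regular ∧ IsNormalMeasure μ ∧ 0 < ∫ ω, f ω ∂μ

end HyperStonian

/-! ### `C(Ω)`-convexity, the canonical fibres and the essential seminorm -/

section Module

variable (Ω : Type u) [TopologicalSpace Ω] [CompactSpace Ω]
variable (X : Type v) [NormedAddCommGroup X] [Module C(Ω, ℂ) X]

/-- The closed unit ball of `X` is `C(Ω)`-convex. -/
def IsCConvex : Prop :=
  ∀ (f g : C(Ω, ℝ)), 0 ≤ f → 0 ≤ g → f + g = 1 →
    ∀ x y : X, ‖x‖ ≤ 1 → ‖y‖ ≤ 1 →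
      ‖(⟨fun ω => (f ω : ℂ), by fun_prop⟩ : C(Ω, ℂ)) • x +
        (⟨fun ω => (g ω : ℂ), by fun_prop⟩ : C(Ω, ℂ)) • y‖ ≤ 1

variable {Ω}

/-- The ideal of continuous functions vanishing at `ω`. -/
def vanishingIdeal (ω : Ω) : Ideal C(Ω, ℂ) where
  carrier := {f | f ω = 0}
  zero_mem' := rfl
  add_mem' := by
    intro f g hf hg
    simp only [Set.mem_ofPred_eq] at hf hg ⊢
    simp [hf, hg]
  smul_mem' := by
    intro c f hf
    simp only [Set.mem_ofPred_eq] at hf ⊢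
    simp [hf]

variable [IsBoundedSMul C(Ω, ℂ) X]

/-- The closed linear span of all `f • x` with `f ω = 0`. -/
def fibreKernel (ω : Ω) : Submodule C(Ω, ℂ) X :=
  (vanishingIdeal ω • (⊤ : Submodule C(Ω, ℂ) X)).topologicalClosure

variable {X}

/-- `|x|(ω) = ‖x(ω)‖`: the norm of the class of `x` in the fibre at `ω` of the bundle
associated with `X`, that is, in the quotient Banach space `X ⧸ fibreKernel X ω`. -/
def fibreNorm (x : X) (ω : Ω) : ℝ :=
  ‖((fibreKernel X ω).mkQ x : X ⧸ fibreKernel X ω)‖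

/-- `‖x‖ₑ`: the infimum, over all open dense `Δ ⊆ Ω`, of the supremum of `|x|` on `Δ`. -/
def essNorm (Ω : Type u) [TopologicalSpace Ω] [CompactSpace Ω]
    {X : Type v} [NormedAddCommGroup X] [Module C(Ω, ℂ) X] [IsBoundedSMul C(Ω, ℂ) X]
    (x : X) : ℝ :=
  ⨅ Δ : {Δ : Set Ω // IsOpen Δ ∧ Dense Δ}, ⨆ ω : Δ.1, fibreNorm x ω.1

lemma fibreNorm_nonneg (x : X) (ω : Ω) : 0 ≤ fibreNorm x ω := norm_nonneg _

lemma fibreNorm_le (x : X) (ω : Ω) : fibreNorm x ω ≤ ‖x‖ :=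
  Submodule.Quotient.norm_mk_le (fibreKernel X ω) x

lemma fibreNorm_add_le (x y : X) (ω : Ω) :
    fibreNorm (x + y) ω ≤ fibreNorm x ω + fibreNorm y ω := by
  unfold fibreNorm
  rw [map_add]
  exact norm_add_le _ _

lemma fibreNorm_smul_le (f : C(Ω, ℂ)) (x : X) (ω : Ω) :
    fibreNorm (f • x) ω ≤ ‖f‖ * fibreNorm x ω := by
  unfold fibreNorm
  rw [map_smul]
  exact norm_smul_le f ((fibreKernel X ω).mkQ x)

lemma fibreNorm_neg (x : X) (ω : Ω) : fibreNorm (-x) ω = fibreNorm x ω := by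
  unfold fibreNorm
  rw [map_neg, norm_neg]

lemma bddAbove_fibreNorm (x : X) (Δ : Set Ω) :
    BddAbove (Set.range fun ω : Δ => fibreNorm x ω.1) :=
  ⟨‖x‖, by rintro _ ⟨ω, rfl⟩; exact fibreNorm_le x _⟩

lemma iSup_fibreNorm_nonneg (x : X) (Δ : Set Ω) : 0 ≤ ⨆ ω : Δ, fibreNorm x ω.1 :=
  Real.iSup_nonneg fun _ => fibreNorm_nonneg x _

lemma bddBelow_iSup_fibreNorm (x : X) :
    BddBelow (Set.range fun Δ : {Δ : Set Ω // IsOpen Δ ∧ Dense Δ} =>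
      ⨆ ω : Δ.1, fibreNorm x ω.1) :=
  ⟨0, by rintro _ ⟨Δ, rfl⟩; exact iSup_fibreNorm_nonneg x _⟩

instance : Nonempty {Δ : Set Ω // IsOpen Δ ∧ Dense Δ} :=
  ⟨⟨Set.univ, isOpen_univ, dense_univ⟩⟩

lemma essNorm_nonneg (x : X) : 0 ≤ essNorm Ω x :=
  Real.iInf_nonneg fun _ => iSup_fibreNorm_nonneg x _

lemma essNorm_zero : essNorm Ω (0 : X) = 0 := by
  have h : ∀ ω : Ω, fibreNorm (0 : X) ω = 0 := fun ω => by simp [fibreNorm]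
  simp [essNorm, h]

lemma essNorm_neg (x : X) : essNorm Ω (-x) = essNorm Ω x := by
  simp only [essNorm, fibreNorm_neg]

lemma essNorm_add_le (x y : X) : essNorm Ω (x + y) ≤ essNorm Ω x + essNorm Ω y := by
  refine le_ciInf_add_ciInf fun Δ₁ Δ₂ => ?_
  have hd : IsOpen (Δ₁.1 ∩ Δ₂.1) ∧ Dense (Δ₁.1 ∩ Δ₂.1) :=
    ⟨Δ₁.2.1.inter Δ₂.2.1, Δ₁.2.2.inter_of_isOpen_left Δ₂.2.2 Δ₁.2.1⟩
  refine (ciInf_le (bddBelow_iSup_fibreNorm (x + y)) ⟨_, hd⟩).trans ?_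
  refine Real.iSup_le (fun ω => (fibreNorm_add_le x y _).trans (add_le_add ?_ ?_))
    (add_nonneg (iSup_fibreNorm_nonneg x _) (iSup_fibreNorm_nonneg y _))
  · exact le_ciSup (bddAbove_fibreNorm x Δ₁.1) ⟨ω.1, ω.2.1⟩
  · exact le_ciSup (bddAbove_fibreNorm y Δ₂.1) ⟨ω.1, ω.2.2⟩

lemma essNorm_smul_le (f : C(Ω, ℂ)) (x : X) : essNorm Ω (f • x) ≤ ‖f‖ * essNorm Ω x := by
  unfold essNorm
  rw [Real.mul_iInf_of_nonneg (norm_nonneg f)]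
  refine ciInf_mono (bddBelow_iSup_fibreNorm (f • x)) fun Δ => ?_
  refine Real.iSup_le (fun ω => (fibreNorm_smul_le f x _).trans ?_)
    (mul_nonneg (norm_nonneg f) (iSup_fibreNorm_nonneg x _))
  exact mul_le_mul_of_nonneg_left (le_ciSup (bddAbove_fibreNorm x Δ.1) ω) (norm_nonneg f)

/-! ### The module `X_ess` -/

variable (Ω X)

/-- The module `X`, to be equipped with the seminorm `‖·‖ₑ`. -/
def EssPre (Ω : Type u) (X : Type v) [TopologicalSpace Ω] : Type v := X

instance : AddCommGroup (EssPre Ω X) := inferInstanceAs (AddCommGroup X)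

instance : Module C(Ω, ℂ) (EssPre Ω X) := inferInstanceAs (Module C(Ω, ℂ) X)

/-- `‖·‖ₑ` as a seminorm on the additive group `X`. -/
def essSeminorm : AddGroupSeminorm (EssPre Ω X) where
  toFun x := essNorm Ω (show X from x)
  map_zero' := essNorm_zero
  add_le' x y := essNorm_add_le (Ω := Ω) (X := X) x y
  neg' x := essNorm_neg (Ω := Ω) (X := X) x

instance : SeminormedAddCommGroup (EssPre Ω X) :=
  (essSeminorm Ω X).toSeminormedAddCommGroup

instance : IsBoundedSMul C(Ω, ℂ) (EssPre Ω X) :=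
  IsBoundedSMul.of_norm_smul_le fun f x => essNorm_smul_le (Ω := Ω) (X := X) f x

/-- `X_ess`: the completion of `X / N` for `‖·‖ₑ`, where `N = {x | ‖x‖ₑ = 0}`. -/
abbrev Ess : Type v := UniformSpace.Completion (SeparationQuotient (EssPre Ω X))

/-- The canonical module map `X → X / N → X_ess`. -/
def toEss : X →ₗ[C(Ω, ℂ)] Ess Ω X where
  toFun x := ((SeparationQuotient.mk (show EssPre Ω X from x) :
    SeparationQuotient (EssPre Ω X)) : Ess Ω X)
  map_add' x y := UniformSpace.Completion.coe_add
    (SeparationQuotient.mk (show EssPre Ω X from x))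
    (SeparationQuotient.mk (show EssPre Ω X from y))
  map_smul' f x := UniformSpace.Completion.coe_smul f
    (SeparationQuotient.mk (show EssPre Ω X from x))

end Module

/-! ### The regular dual and regularity -/

section Regular

variable (Ω : Type u) [TopologicalSpace Ω] [CompactSpace Ω]
variable (X : Type v) [NormedAddCommGroup X] [NormedSpace ℂ X] [Module C(Ω, ℂ) X]

/-- The continuous `C(Ω)`-module maps `X → C(Ω)`, a `C(Ω)`-submodule of the space of bounded
linear maps with its operator norm; the action is `(f • T) x = f * T x`. -/
def regularDual : Submodule C(Ω, ℂ) (X →L[ℂ] C(Ω, ℂ)) where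
  carrier := {T | ∀ (f : C(Ω, ℂ)) (x : X), T (f • x) = f * T x}
  zero_mem' := by intro f x; simp
  add_mem' := by
    intro S T hS hT f x
    simp [hS f x, hT f x, mul_add]
  smul_mem' := by
    intro g T hT f x
    simp [hT f x, mul_left_comm]

/-- `X^s`, the regular dual of `X`, a normed `C(Ω)`-module. (For the commutative unital algebra
`A = C(Ω)` the bimodule `A ⊗_{Z(A)} A` in which dual maps take values is `C(Ω)` itself.) -/
abbrev RegularDual : Type (max u v) := ↥(regularDual Ω X)

/-- The canonical map `κ : X → X^{ss}`, `κ x φ = φ x`. -/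
def kappa : X →ₗ[C(Ω, ℂ)] RegularDual Ω (RegularDual Ω X) where
  toFun x :=
    ⟨(ContinuousLinearMap.apply ℂ C(Ω, ℂ) x).comp
      ((regularDual Ω X).restrictScalars ℂ).subtypeL, fun _ _ => rfl⟩
  map_add' x y := by
    apply Subtype.ext
    ext1 φ
    exact map_add φ.1 x y
  map_smul' f x := by
    apply Subtype.ext
    ext1 φ
    exact φ.2 f x

/-- `X` is regular if `κ` is an isometry. -/
def IsRegular : Prop := Isometry (kappa Ω X)

end Regular

/-! ### Banach bundles and their continuous sections -/

/-- The disjoint union of a family of sets (without any topology). -/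
structure Total {Ω : Type u} (E : Ω → Type v) : Type (max u v) where
  proj : Ω
  point : E proj

/-- An (H)-Banach bundle over `Ω`: a continuous open surjection from the total space onto `Ω`
(surjectivity holds because every fibre contains `0`), whose fibres are complex Banach spaces;
the norm is only required to be upper semicontinuous. -/
structure HBundle (Ω : Type u) [TopologicalSpace Ω] where
  Fibre : Ω → Type v
  [normed : ∀ ω, NormedAddCommGroup (Fibre ω)]
  [space : ∀ ω, NormedSpace ℂ (Fibre ω)]
  [complete : ∀ ω, CompleteSpace (Fibre ω)]
  [top : TopologicalSpace (Total Fibre)]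
  continuous_proj : Continuous (Total.proj : Total Fibre → Ω)
  isOpenMap_proj : IsOpenMap (Total.proj : Total Fibre → Ω)
  /-- Addition is continuous on the fibre product, with the topology induced from the square of
  the total space. -/
  continuous_add :
    @Continuous (Total fun ω => Fibre ω × Fibre ω) (Total Fibre)
      (TopologicalSpace.induced (fun q => ((⟨q.proj, q.point.1⟩ : Total Fibre),
        (⟨q.proj, q.point.2⟩ : Total Fibre))) inferInstance) top
      (fun q => ⟨q.proj, q.point.1 + q.point.2⟩)
  continuous_smul :
    Continuous fun q : ℂ × Total Fibre => (⟨q.2.proj, q.1 • q.2.point⟩ : Total Fibre)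
  upperSemicontinuous_norm : UpperSemicontinuous fun e : Total Fibre => ‖e.point‖
  /-- The tubes around zero form a neighbourhood basis at each zero vector. -/
  nhds_zero : ∀ ω : Ω, (nhds (⟨ω, 0⟩ : Total Fibre)).HasBasis
    (fun q : Set Ω × ℝ => q.1 ∈ nhds ω ∧ 0 < q.2)
    (fun q => {e | e.proj ∈ q.1 ∧ ‖e.point‖ < q.2})

namespace HBundle

attribute [instance] HBundle.normed HBundle.space HBundle.complete HBundle.top

variable {Ω : Type u} [TopologicalSpace Ω] (E : HBundle.{u, v} Ω)

/-- An (F)-Banach bundle is an (H)-Banach bundle whose norm is continuous. -/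
def IsF : Prop := Continuous fun e : Total E.Fibre => ‖e.point‖

/-- `Γ(E)`: the continuous sections of `E`. -/
def sections : AddSubgroup (∀ ω, E.Fibre ω) where
  carrier := {s | Continuous fun ω => (⟨ω, s ω⟩ : Total E.Fibre)}
  zero_mem' := by
    refine continuous_iff_continuousAt.2 fun ω => ?_
    refine ((E.nhds_zero ω).tendsto_right_iff).2 fun q hq => ?_
    filter_upwards [hq.1] with ω' h'
    exact ⟨h', by simpa using hq.2⟩
  add_mem' := by
    intro s t hs ht
    have h : @Continuous Ω (Total fun ω => E.Fibre ω × E.Fibre ω) _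
        (TopologicalSpace.induced (fun q => ((⟨q.proj, q.point.1⟩ : Total E.Fibre),
          (⟨q.proj, q.point.2⟩ : Total E.Fibre))) inferInstance)
        (fun ω => ⟨ω, (s ω, t ω)⟩) :=
      continuous_induced_rng.2 (Continuous.prodMk hs ht)
    exact @Continuous.comp _ _ _ _ (_) _ _ _ E.continuous_add h
  neg_mem' := by
    intro s hs
    have h := E.continuous_smul.comp (Continuous.prodMk (continuous_const (y := (-1 : ℂ))) hs)
    simpa [Function.comp_def] using h

/-- `Γ(E)` as a type. -/
def Sections : Type (max u v) := ↥E.sections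

instance : AddCommGroup E.Sections := inferInstanceAs (AddCommGroup ↥E.sections)

variable {E}

@[ext]
lemma Sections.ext {s t : E.Sections} (h : ∀ ω, s.1 ω = t.1 ω) : s = t :=
  Subtype.ext (funext h)

instance : SMul C(Ω, ℂ) E.Sections where
  smul f s := ⟨fun ω => f ω • s.1 ω,
    E.continuous_smul.comp (Continuous.prodMk f.continuous s.2)⟩

lemma smul_apply (f : C(Ω, ℂ)) (s : E.Sections) (ω : Ω) : (f • s).1 ω = f ω • s.1 ω := rfl

lemma zero_apply (ω : Ω) : (0 : E.Sections).1 ω = 0 := rfl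

lemma neg_apply (s : E.Sections) (ω : Ω) : (-s).1 ω = -s.1 ω := rfl

lemma add_apply (s t : E.Sections) (ω : Ω) : (s + t).1 ω = s.1 ω + t.1 ω := rfl

/-- The pointwise `C(Ω)`-module structure of `Γ(E)`. -/
instance : Module C(Ω, ℂ) E.Sections where
  one_smul s := by ext ω; simp [smul_apply]
  mul_smul f g s := by ext ω; simp [smul_apply, mul_smul]
  smul_zero f := by ext ω; simp [smul_apply, zero_apply]
  smul_add f s t := by ext ω; simp [smul_apply, add_apply]
  add_smul f g s := by ext ω; simp [smul_apply, add_apply, add_smul]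
  zero_smul s := by ext ω; simp [smul_apply, zero_apply]

variable [CompactSpace Ω]

lemma bddAbove_norm (s : E.Sections) : BddAbove (Set.range fun ω => ‖s.1 ω‖) := by
  have h : UpperSemicontinuous fun ω => ‖s.1 ω‖ := E.upperSemicontinuous_norm.comp s.2
  simpa using (h.upperSemicontinuousOn Set.univ).bddAbove_of_isCompact isCompact_univ

/-- The supremum norm on `Γ(E)`. -/
def supNorm (E : HBundle.{u, v} Ω) : AddGroupNorm E.Sections where
  toFun s := ⨆ ω, ‖s.1 ω‖
  map_zero' := by simp [zero_apply]
  add_le' s t := by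
    refine Real.iSup_le (fun ω => (norm_add_le (s.1 ω) (t.1 ω)).trans (add_le_add ?_ ?_))
      (add_nonneg (Real.iSup_nonneg fun _ => norm_nonneg _)
        (Real.iSup_nonneg fun _ => norm_nonneg _))
    · exact le_ciSup (bddAbove_norm s) ω
    · exact le_ciSup (bddAbove_norm t) ω
  neg' s := by simp [neg_apply]
  eq_zero_of_map_eq_zero' s hs := by
    ext ω
    have h : ‖s.1 ω‖ ≤ 0 := (le_ciSup (bddAbove_norm s) ω).trans_eq hs
    simpa [zero_apply] using h

instance : NormedAddCommGroup E.Sections := (supNorm E).toNormedAddCommGroup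

end HBundle

end

end BanachModule

/-!
All three conditions are equivalent to the existence of a *continuous pointwise norm* on `X`: a map
`N : X → C(Ω, ℝ)` with `N (x + y) ≤ N x + N y`, `N (f • x) ≤ |f| * N x` and `‖N x‖ = ‖x‖`
(`PointwiseNorm`). Extremal disconnectedness of `Ω` makes the lower regularization
`ω ↦ inf {r | ω ∈ closure {n < r}}` of a bounded upper semicontinuous function `n`
continuous (`exists_lowerRegularization`), and hence `C(Ω, ℝ)` Dedekind complete
(`exists_isGLB`, `exists_isLUB`).

* The canonical map to `X_ess` is isometric exactly if `‖x‖ₑ = ‖x‖` for all `x`, and is then onto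
  because its range is dense and complete. The functions `ω ↦ ‖x(ω)‖` are upper semicontinuous. If
  `‖x‖ₑ = ‖x‖`, their lower regularizations form a pointwise norm
  (`exists_pointwiseNorm_of_essNorm`): if the regularization is everywhere below `r`, then
  `‖x(ω)‖ < r` on an open dense set, so `‖x‖ₑ ≤ r`. Conversely every pointwise norm satisfies
  `N x ω ≤ ‖x(ω)‖`, and by continuity its supremum over a dense set is already `‖x‖`
  (`PointwiseNorm.isometry_toEss`).
* If `X` is regular, the suprema in `C(Ω, ℝ)` of the functions `|φ x|`, for `φ` in the unit ball of
  the regular dual, form a pointwise norm (`exists_pointwiseNorm_of_isRegular`). Conversely, the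
  Hahn–Banach–Kantorovich theorem (`IsSublinear.exists_linearMap_le`) yields, for given `x`, a real
  linear map `T : X → C(Ω, ℝ)` with `T ≤ N` and `T x = N x`. Its complexification `φ` satisfies
  `|φ y| ≤ N y` pointwise, so `φ (f • y - f ω • y)` vanishes at `ω`, which makes `φ`
  a module map (`PointwiseNorm.exists_regularDual`).
* The pointwise norm of the sections of an (F)-Banach bundle is a pointwise norm. Conversely, the
  completions of `X` for the seminorms `x ↦ N x ω` are the fibres of an (F)-Banach bundle
  (`PointwiseNorm.bundle`), topologized by its projection and the distances to the sections coming
  from `X`. Gluing along clopen sets shows that these sections are dense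
  (`PointwiseNorm.denseRange_toSections`), hence all sections, as `X` is complete.
-/

namespace BanachModule

noncomputable section

/-! ### Dedekind completeness of `C(Ω, ℝ)` -/

section Stonian

variable {Ω : Type u} [TopologicalSpace Ω]

/-- The lower regularization `ω ↦ inf {r | ω ∈ closure {n < r}}` of a bounded upper semicontinuous
function `n` on an extremally disconnected space. It is continuous because the sets
`closure {n < r}` are clopen. -/
lemma exists_lowerRegularization [ExtremallyDisconnected Ω] {n : Ω → ℝ}
    (hn : UpperSemicontinuous n) {m M : ℝ} (hm : ∀ ω, m ≤ n ω) (hM : ∀ ω, n ω ≤ M) :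
    ∃ g : C(Ω, ℝ), ∀ (ω : Ω) (r : ℝ), (g ω < r → ω ∈ closure {a | n a < r}) ∧
      (ω ∈ closure {a | n a < r} → g ω ≤ r) := by
  have hmono : ∀ {q r : ℝ}, q ≤ r → closure {a | n a < q} ⊆ closure {a | n a < r} :=
    fun h => closure_mono fun a (ha : n a < _) => lt_of_lt_of_le ha h
  have hopen : ∀ r, IsOpen (closure {a | n a < r}) := fun r =>
    ExtremallyDisconnected.open_closure _ (upperSemicontinuous_iff_isOpen_preimage.1 hn r)
  have hne : ∀ ω, {r | ω ∈ closure {a | n a < r}}.Nonempty := fun ω =>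
    ⟨M + 1, subset_closure (show n ω < M + 1 by linarith [hM ω])⟩
  have hbdd : ∀ ω, BddBelow {r | ω ∈ closure {a | n a < r}} := by
    refine fun ω => ⟨m, fun r hr => ?_⟩
    obtain ⟨a, ha⟩ := closure_nonempty_iff.1 ⟨ω, hr⟩
    exact (hm a).trans (le_of_lt ha)
  have hlt : ∀ ω r, sInf {r | ω ∈ closure {a | n a < r}} < r →
      ∃ q < r, ω ∈ closure {a | n a < q} := fun ω r h => by
    obtain ⟨q, hq, hqr⟩ := exists_lt_of_csInf_lt (hne ω) h
    exact ⟨q, hqr, hq⟩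
  have hle : ∀ ω r, ω ∈ closure {a | n a < r} → sInf {r | ω ∈ closure {a | n a < r}} ≤ r :=
    fun ω r h => csInf_le (hbdd ω) h
  refine ⟨⟨fun ω => sInf {r | ω ∈ closure {a | n a < r}}, ?_⟩, fun ω r => ⟨fun h => ?_, hle ω r⟩⟩
  · refine continuous_iff_lower_upperSemicontinuous.2 ⟨fun ω r hr => ?_, fun ω r hr => ?_⟩
    · obtain ⟨q, hrq, hq⟩ := exists_between hr
      have hω : ω ∉ closure {a | n a < q} := fun h => (hle ω q h).not_gt hq
      filter_upwards [isClosed_closure.isOpen_compl.mem_nhds hω] with a ha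
      refine hrq.trans_le (not_lt.1 fun h => ?_)
      obtain ⟨q', hq', h'⟩ := hlt a q h
      exact ha (hmono hq'.le h')
    · obtain ⟨q, hqr, hq⟩ := hlt ω r hr
      filter_upwards [(hopen q).mem_nhds hq] with a ha
      exact (hle a q ha).trans_lt hqr
  · obtain ⟨q, hqr, hq⟩ := hlt ω r h
    exact hmono hqr.le hq

/-- The infimum in `C(Ω, ℝ)` is the lower regularization of the pointwise infimum. -/
lemma exists_isGLB [CompactSpace Ω] [ExtremallyDisconnected Ω] (D : Set C(Ω, ℝ))
    (hne : D.Nonempty) (hD : BddBelow D) :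
    ∃ g, IsGLB D g := by
  obtain ⟨b, hb⟩ := hD
  obtain ⟨f₀, hf₀⟩ := hne
  have hbdd : ∀ ω, BddBelow ((fun f : C(Ω, ℝ) => f ω) '' D) := fun ω =>
    ⟨b ω, by rintro _ ⟨f, hf, rfl⟩; exact hb hf ω⟩
  have hle : ∀ f ∈ D, ∀ ω, sInf ((fun f : C(Ω, ℝ) => f ω) '' D) ≤ f ω := fun f hf ω =>
    csInf_le (hbdd ω) ⟨f, hf, rfl⟩
  have hge : ∀ h ∈ lowerBounds D, ∀ ω, h ω ≤ sInf ((fun f : C(Ω, ℝ) => f ω) '' D) :=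
    fun h hh ω => le_csInf ⟨_, f₀, hf₀, rfl⟩ (by rintro _ ⟨f, hf, rfl⟩; exact hh hf ω)
  have husc : UpperSemicontinuous fun ω => sInf ((fun f : C(Ω, ℝ) => f ω) '' D) := by
    intro ω r hr
    obtain ⟨_, ⟨f, hf, rfl⟩, hfr⟩ := exists_lt_of_csInf_lt (Set.Nonempty.image _ ⟨f₀, hf₀⟩) hr
    filter_upwards [f.continuous.continuousAt.eventually_lt continuousAt_const hfr] with a ha
    exact (hle f hf a).trans_lt ha
  obtain ⟨g, hg⟩ := exists_lowerRegularization husc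
    (m := -‖b‖) (M := ‖f₀‖) (fun ω => (neg_le_of_abs_le (b.norm_coe_le_norm ω)).trans (hge b hb ω))
    (fun ω => (hle f₀ hf₀ ω).trans ((le_abs_self _).trans (f₀.norm_coe_le_norm ω)))
  refine ⟨g, fun f hf ω => ?_, fun h hh ω => ?_⟩
  · refine le_of_forall_gt_imp_ge_of_dense fun r hr => (hg ω r).2 (subset_closure ?_)
    exact (hle f hf ω).trans_lt hr
  · refine le_of_forall_gt_imp_ge_of_dense fun r hr => ?_
    have hcl : closure {a | sInf ((fun f : C(Ω, ℝ) => f a) '' D) < r} ⊆ {a | h a ≤ r} :=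
      closure_minimal (fun a ha => (hge h hh a).trans (le_of_lt ha))
        (isClosed_le h.continuous continuous_const)
    exact hcl ((hg ω r).1 hr)

lemma exists_isLUB [CompactSpace Ω] [ExtremallyDisconnected Ω] (D : Set C(Ω, ℝ))
    (hne : D.Nonempty) (hD : BddAbove D) :
    ∃ g, IsLUB D g := by
  obtain ⟨g, hg⟩ := exists_isGLB (-D) hne.neg hD.neg
  exact ⟨-g, isGLB_neg'.1 (by simpa using hg)⟩

end Stonian

/-! ### The Hahn–Banach–Kantorovich theorem -/

section Sublinear

variable {E : Type*} {F : Type*} [AddCommGroup E] [Module ℝ E]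
  [AddCommGroup F] [Module ℝ F] [PartialOrder F]

/-- Sublinear maps from a real vector space to an ordered vector space. Equality in `smul_le`
follows by applying it to `t⁻¹`. -/
structure IsSublinear (q : E → F) : Prop where
  add_le : ∀ x y, q (x + y) ≤ q x + q y
  smul_le : ∀ t : ℝ, 0 < t → ∀ x, q (t • x) ≤ t • q x

variable [IsOrderedAddMonoid F] [PosSMulMono ℝ F]

namespace IsSublinear

variable {q : E → F}

omit [PosSMulMono ℝ F] in
protected lemma map_zero (hq : IsSublinear q) : q 0 = 0 := by
  refine le_antisymm ?_ ?_
  · have h := hq.smul_le (1 / 2) (by norm_num) 0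
    rw [smul_zero] at h
    have h2 := add_le_add h h
    rw [← add_smul] at h2
    norm_num at h2
    exact h2
  · simpa using hq.add_le 0 0

omit [PosSMulMono ℝ F] in
lemma neg_le_self (hq : IsSublinear q) (x : E) : -q (-x) ≤ q x := by
  have h := hq.add_le x (-x)
  rw [add_neg_cancel, hq.map_zero] at h
  exact neg_le_iff_add_nonneg.2 h

lemma le_smul (hq : IsSublinear q) {t : ℝ} (ht : 0 ≤ t) (x : E) : t • q x ≤ q (t • x) := by
  rcases ht.eq_or_lt with rfl | ht
  · simp [hq.map_zero]
  · have h := smul_le_smul_of_nonneg_left (hq.smul_le t⁻¹ (inv_pos.2 ht) (t • x)) ht.le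
    rwa [inv_smul_smul₀ ht.ne', smul_inv_smul₀ ht.ne'] at h

end IsSublinear

omit [IsOrderedAddMonoid F] in
lemma le_smul_of_isGLB {A : Set F} {a w : F} (h : IsGLB A a) {t : ℝ} (ht : 0 < t)
    (hw : ∀ x ∈ A, w ≤ t • x) : w ≤ t • a := by
  have h' : t⁻¹ • w ≤ a := h.2 fun x hx => by
    simpa [inv_smul_smul₀ ht.ne'] using
      smul_le_smul_of_nonneg_left (hw x hx) (inv_pos.2 ht).le
  simpa [smul_inv_smul₀ ht.ne'] using smul_le_smul_of_nonneg_left h' ht.le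

variable (hF : ∀ D : Set F, D.Nonempty → BddBelow D → ∃ g, IsGLB D g)
include hF

/-- Below every sublinear map `q` there is a sublinear map attaining the smallest possible value
`-q y` at `-y`, namely `x ↦ inf {q (x + t • y) - t • q y | 0 ≤ t}`. -/
lemma IsSublinear.exists_le_neg {q : E → F} (hq : IsSublinear q) (y : E) :
    ∃ q', IsSublinear q' ∧ q' ≤ q ∧ q' (-y) ≤ -q y := by
  have hex : ∀ x, ∃ g, IsGLB {z | ∃ t : ℝ, 0 ≤ t ∧ z = q (x + t • y) - t • q y} g := by
    refine fun x => hF _ ⟨_, 0, le_rfl, rfl⟩ ⟨-q (-x), ?_⟩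
    rintro _ ⟨t, ht, rfl⟩
    have h := hq.add_le (x + t • y) (-x)
    rw [add_neg_cancel_comm] at h
    have h2 := (hq.le_smul ht y).trans h
    rw [le_sub_iff_add_le, neg_add_le_iff_le_add, add_comm]
    exact h2
  choose I hI using hex
  refine ⟨I, ⟨fun x x' => ?_, fun s hs x => ?_⟩, fun x => ?_, ?_⟩
  · refine (IsGLB.add (hI x) (hI x')).2 ?_
    rintro _ ⟨_, ⟨t, ht, rfl⟩, _, ⟨t', ht', rfl⟩, rfl⟩
    refine ((hI (x + x')).1 ⟨t + t', add_nonneg ht ht', rfl⟩).trans ?_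
    have h := hq.add_le (x + t • y) (x' + t' • y)
    beta_reduce
    rw [sub_add_sub_comm, ← add_smul]
    refine sub_le_sub_right ?_ _
    rwa [add_smul, add_add_add_comm]
  · refine le_smul_of_isGLB (hI x) hs ?_
    rintro _ ⟨t, ht, rfl⟩
    refine ((hI (s • x)).1 ⟨s * t, mul_nonneg hs.le ht, rfl⟩).trans ?_
    have h := hq.smul_le s hs (x + t • y)
    rw [smul_sub, smul_smul]
    refine sub_le_sub_right ?_ _
    rwa [smul_add, smul_smul] at h
  · simpa using (hI x).1 ⟨0, le_rfl, rfl⟩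
  · simpa [hq.map_zero] using (hI (-y)).1 ⟨1, zero_le_one, rfl⟩

/-- Zorn's lemma applies because the pointwise infimum of a chain of sublinear maps is sublinear. -/
lemma IsSublinear.exists_minimal {p : E → F} (hp : IsSublinear p) :
    ∃ q ≤ p, Minimal IsSublinear q := by
  have hchains : ∀ c ⊆ {q : (E → F)ᵒᵈ | IsSublinear (OrderDual.ofDual q) ∧ OrderDual.ofDual q ≤ p},
      IsChain (· ≤ ·) c → ∀ y ∈ c, ∃ ub ∈ {q : (E → F)ᵒᵈ | IsSublinear (OrderDual.ofDual q) ∧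
        OrderDual.ofDual q ≤ p}, ∀ z ∈ c, z ≤ ub := by
    intro c hc hchain q₀ hq₀
    have hex : ∀ x, ∃ g, IsGLB {z | ∃ q ∈ c, z = OrderDual.ofDual q x} g := by
      refine fun x => hF _ ⟨_, q₀, hq₀, rfl⟩ ⟨-p (-x), ?_⟩
      rintro _ ⟨q, hq, rfl⟩
      exact (neg_le_neg ((hc hq).2 (-x))).trans ((hc hq).1.neg_le_self x)
    choose I hI using hex
    refine ⟨OrderDual.toDual I, ⟨⟨fun x y => ?_, fun t ht x => ?_⟩, fun x => ?_⟩, fun q hq x => ?_⟩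
    · refine (IsGLB.add (hI x) (hI y)).2 ?_
      rintro _ ⟨_, ⟨q₁, h₁, rfl⟩, _, ⟨q₂, h₂, rfl⟩, rfl⟩
      rcases hchain.total h₁ h₂ with h | h
      · refine ((hI (x + y)).1 ⟨q₂, h₂, rfl⟩).trans (((hc h₂).1.add_le x y).trans ?_)
        exact add_le_add_left (h x) _
      · refine ((hI (x + y)).1 ⟨q₁, h₁, rfl⟩).trans (((hc h₁).1.add_le x y).trans ?_)
        exact add_le_add_right (h y) _
    · refine le_smul_of_isGLB (hI x) ht ?_
      rintro _ ⟨q, hq, rfl⟩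
      exact ((hI (t • x)).1 ⟨q, hq, rfl⟩).trans ((hc hq).1.smul_le t ht x)
    · exact ((hI x).1 ⟨q₀, hq₀, rfl⟩).trans ((hc hq₀).2 x)
    · exact (hI x).1 ⟨q, hq, rfl⟩
  obtain ⟨m, hm, hmin⟩ := zorn_le_nonempty₀ _ hchains (OrderDual.toDual p) ⟨hp, le_rfl⟩
  refine ⟨OrderDual.ofDual m, hm, hmin.1.1, fun q hq hqm => ?_⟩
  exact hmin.2 (y := OrderDual.toDual q) ⟨hq, le_trans hqm hm⟩ hqm

/-- Hahn–Banach–Kantorovich: a sublinear map into a Dedekind complete ordered vector space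
dominates a linear map touching it at a prescribed point, because minimal sublinear maps are
linear. -/
theorem IsSublinear.exists_linearMap_le {p : E → F} (hp : IsSublinear p) (x₀ : E) :
    ∃ T : E →ₗ[ℝ] F, (∀ x, T x ≤ p x) ∧ T x₀ = p x₀ := by
  -- Minimality is applied to `p'` with `p' (-x₀) ≤ -p x₀`, which forces the value `p x₀` at `x₀`.
  obtain ⟨p', hp', hpp', hx₀⟩ := hp.exists_le_neg hF x₀
  obtain ⟨q, hqp, hq, hmin⟩ := hp'.exists_minimal hF
  have hneg : ∀ x, q (-x) ≤ -q x := fun x => by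
    obtain ⟨q', hq', hle, hx⟩ := hq.exists_le_neg hF x
    exact (hmin hq' hle (-x)).trans hx
  have hneg' : ∀ x, q (-x) = -q x := fun x =>
    le_antisymm (hneg x) (neg_le.1 (hq.neg_le_self x))
  have hadd : ∀ x y, q (x + y) = q x + q y := fun x y => by
    refine le_antisymm (hq.add_le x y) ?_
    have h := hq.add_le (-x) (-y)
    rw [← neg_add, hneg', hneg', hneg', ← neg_add] at h
    exact neg_le_neg_iff.1 h
  have hpos : ∀ t : ℝ, 0 ≤ t → ∀ x, q (t • x) = t • q x := fun t ht x => by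
    rcases ht.eq_or_lt with rfl | ht'
    · simp [hq.map_zero]
    · exact le_antisymm (hq.smul_le t ht' x) (hq.le_smul ht x)
  refine ⟨⟨⟨q, hadd⟩, fun t x => ?_⟩, fun x => (hqp x).trans (hpp' x),
    le_antisymm ((hqp x₀).trans (hpp' x₀)) ?_⟩
  · rcases le_total 0 t with ht | ht
    · exact hpos t ht x
    · have h := hpos (-t) (neg_nonneg.2 ht) x
      rw [neg_smul, neg_smul, hneg'] at h
      exact neg_injective h
  · have h := (hqp (-x₀)).trans hx₀
    rw [hneg'] at h
    exact neg_le_neg_iff.1 h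

end Sublinear

/-! ### Continuous pointwise norms -/

section PointwiseNorm

variable (Ω : Type u) [TopologicalSpace Ω] [CompactSpace Ω]
variable (X : Type v) [NormedAddCommGroup X] [Module C(Ω, ℂ) X]

/-- A `C(Ω, ℝ)`-valued norm on `X` which is compatible with the `C(Ω, ℂ)`-module structure and
recovers the norm of `X` as its supremum. Equality in `smul_le` is automatic. -/
structure PointwiseNorm where
  toFun : X → C(Ω, ℝ)
  add_le : ∀ x y ω, toFun (x + y) ω ≤ toFun x ω + toFun y ω
  smul_le : ∀ (f : C(Ω, ℂ)) x ω, toFun (f • x) ω ≤ ‖f ω‖ * toFun x ω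
  norm_eq : ∀ x, ‖toFun x‖ = ‖x‖

namespace PointwiseNorm

variable {Ω X}

instance : CoeFun (PointwiseNorm Ω X) fun _ => X → C(Ω, ℝ) := ⟨toFun⟩

variable (N : PointwiseNorm Ω X)

protected lemma map_zero (ω : Ω) : N 0 ω = 0 := by
  refine le_antisymm ?_ ?_
  · simpa using N.smul_le 0 0 ω
  · simpa using N.add_le 0 0 ω

protected lemma neg_le (x : X) (ω : Ω) : N (-x) ω ≤ N x ω := by
  simpa using N.smul_le (-1) x ω

protected lemma map_neg (x : X) (ω : Ω) : N (-x) ω = N x ω :=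
  le_antisymm (N.neg_le x ω) (by simpa using N.neg_le (-x) ω)

protected lemma nonneg (x : X) (ω : Ω) : 0 ≤ N x ω := by
  have h := N.add_le x (-x) ω
  rw [add_neg_cancel, N.map_zero, N.map_neg] at h
  linarith

lemma apply_le_norm (x : X) (ω : Ω) : N x ω ≤ ‖x‖ :=
  (le_abs_self _).trans (((N x).norm_coe_le_norm ω).trans_eq (N.norm_eq x))

protected lemma sub_le (x y : X) (ω : Ω) : |N x ω - N y ω| ≤ N (x - y) ω := by
  have h₁ := N.add_le (x - y) y ω
  have h₂ := N.add_le (y - x) x ω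
  rw [sub_add_cancel] at h₁ h₂
  rw [← neg_sub x y, N.map_neg] at h₂
  exact abs_le.2 ⟨by linarith, by linarith⟩

lemma eq_of_sub_eq_zero {x y : X} {ω : Ω} (h : N (x - y) ω = 0) : N x ω = N y ω := by
  have := N.sub_le x y ω
  rw [h] at this
  exact sub_eq_zero.1 (abs_nonpos_iff.1 this)

protected lemma continuous : Continuous fun x => N x := by
  refine LipschitzWith.continuous (K := 1) (LipschitzWith.of_dist_le_mul fun x y => ?_)
  rw [NNReal.coe_one, one_mul, dist_eq_norm x y]
  refine (ContinuousMap.dist_le (norm_nonneg _)).2 fun ω => ?_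
  exact (N.sub_le x y ω).trans (N.apply_le_norm _ ω)

variable [NormedSpace ℂ X] [IsScalarTower ℂ C(Ω, ℂ) X]

omit [CompactSpace Ω] in
/-- Scalars act through the constant functions. -/
lemma const_smul_eq (c : ℂ) (x : X) : (ContinuousMap.const Ω c : C(Ω, ℂ)) • x = c • x := by
  rw [← algebraMap_smul C(Ω, ℂ) c x]
  rfl

protected lemma map_smul (c : ℂ) (x : X) (ω : Ω) : N (c • x) ω = ‖c‖ * N x ω := by
  have hle : ∀ (c : ℂ) (x : X), N (c • x) ω ≤ ‖c‖ * N x ω := fun c x => by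
    rw [← const_smul_eq (Ω := Ω) c x]
    exact N.smul_le _ x ω
  rcases eq_or_ne c 0 with rfl | hc
  · simp [N.map_zero]
  · refine le_antisymm (hle c x) ?_
    have h := hle c⁻¹ (c • x)
    rw [inv_smul_smul₀ hc, norm_inv] at h
    rwa [le_inv_mul_iff₀ (norm_pos_iff.2 hc)] at h

/-- At `ω`, multiplication by `f` is indistinguishable from multiplication by `f ω`. -/
lemma smul_sub_smul_eq_zero (f : C(Ω, ℂ)) (x : X) (ω : Ω) : N (f • x - f ω • x) ω = 0 := by
  refine le_antisymm ?_ (N.nonneg _ _)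
  rw [← const_smul_eq (Ω := Ω) (f ω) x, ← sub_smul]
  simpa using N.smul_le (f - ContinuousMap.const Ω (f ω)) x ω

end PointwiseNorm

/-! ### Pointwise norms and the essential norm -/

variable {Ω X}

section Ess

variable [IsBoundedSMul C(Ω, ℂ) X]

lemma fibreNorm_eq_zero_of_mem {x : X} {ω : Ω} (h : x ∈ fibreKernel X ω) : fibreNorm x ω = 0 := by
  simp [fibreNorm, (Submodule.Quotient.mk_eq_zero _).2 h]

lemma smul_mem_fibreKernel {f : C(Ω, ℂ)} {ω : Ω} (hf : f ω = 0) (x : X) :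
    f • x ∈ fibreKernel X ω :=
  Submodule.le_topologicalClosure _ (Submodule.smul_mem_smul (show f ∈ vanishingIdeal ω from hf)
    Submodule.mem_top)

lemma fibreNorm_smul_le_apply (f : C(Ω, ℂ)) (x : X) (ω : Ω) :
    fibreNorm (f • x) ω ≤ ‖f ω‖ * fibreNorm x ω := by
  have h₀ : fibreNorm ((f - ContinuousMap.const Ω (f ω)) • x) ω = 0 :=
    fibreNorm_eq_zero_of_mem (smul_mem_fibreKernel (by simp) x)
  have h₁ := fibreNorm_add_le ((f - ContinuousMap.const Ω (f ω)) • x)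
    ((ContinuousMap.const Ω (f ω) : C(Ω, ℂ)) • x) ω
  rw [h₀, zero_add, ← add_smul, sub_add_cancel] at h₁
  have h₂ : ‖(ContinuousMap.const Ω (f ω) : C(Ω, ℂ))‖ ≤ ‖f ω‖ :=
    (ContinuousMap.norm_le _ (norm_nonneg _)).2 fun _ => le_rfl
  exact (h₁.trans (fibreNorm_smul_le _ x ω)).trans
    (mul_le_mul_of_nonneg_right h₂ (fibreNorm_nonneg x ω))

lemma eventually_fibreNorm_lt_of_mem {x : X} {ω : Ω} (h : x ∈ fibreKernel X ω) {ε : ℝ}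
    (hε : 0 < ε) : ∀ᶠ a in nhds ω, fibreNorm x a < ε := by
  -- Elements of the algebraic span first; the general case follows by approximation.
  have hspan : ∀ k ∈ vanishingIdeal ω • (⊤ : Submodule C(Ω, ℂ) X), ∀ ε : ℝ, 0 < ε →
      ∀ᶠ a in nhds ω, fibreNorm k a < ε := by
    intro k hk
    induction hk using Submodule.smul_induction_on' with
    | smul f hf y _ =>
      intro ε hε
      have hc : ContinuousAt (fun a => ‖f a‖ * ‖y‖) ω := by fun_prop
      have h₀ : ‖f ω‖ * ‖y‖ < ε := by
        rw [show f ω = 0 from hf]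
        simpa using hε
      filter_upwards [hc.eventually_lt continuousAt_const h₀] with a ha
      exact (fibreNorm_smul_le_apply f y a).trans_lt
        ((mul_le_mul_of_nonneg_left (fibreNorm_le y a) (norm_nonneg _)).trans_lt ha)
    | add y _ z _ hy hz =>
      intro ε hε
      filter_upwards [hy (ε / 2) (half_pos hε), hz (ε / 2) (half_pos hε)] with a h₁ h₂
      linarith [fibreNorm_add_le y z a]
  have hx : x ∈ closure
      ((vanishingIdeal ω • (⊤ : Submodule C(Ω, ℂ) X) : Submodule C(Ω, ℂ) X) : Set X) := h
  obtain ⟨k, hk, hxk⟩ := Metric.mem_closure_iff.1 hx (ε / 2) (half_pos hε)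
  filter_upwards [hspan k hk (ε / 2) (half_pos hε)] with a ha
  have h₁ := fibreNorm_add_le (x - k) k a
  rw [sub_add_cancel] at h₁
  rw [dist_eq_norm] at hxk
  linarith [fibreNorm_le (x - k) a]

lemma exists_mem_fibreKernel_norm_add_lt {x : X} {ω : Ω} {r : ℝ} (h : fibreNorm x ω < r) :
    ∃ k ∈ fibreKernel X ω, ‖x + k‖ < r := by
  obtain ⟨y, hy, hyr⟩ := Submodule.Quotient.norm_mk_lt ((fibreKernel X ω).mkQ x) (sub_pos.2 h)
  refine ⟨y - x, (Submodule.Quotient.eq _).1 hy, ?_⟩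
  rw [add_sub_cancel]
  unfold fibreNorm at hyr
  linarith

lemma upperSemicontinuous_fibreNorm (x : X) : UpperSemicontinuous fun ω : Ω => fibreNorm x ω := by
  intro ω r hr
  obtain ⟨k, hk, hxk⟩ := exists_mem_fibreKernel_norm_add_lt hr
  filter_upwards [eventually_fibreNorm_lt_of_mem ((fibreKernel X ω).neg_mem hk)
    (sub_pos.2 hxk)] with a ha
  have h₁ := fibreNorm_add_le (x + k) (-k) a
  rw [add_neg_cancel_right] at h₁
  linarith [fibreNorm_le (x + k) a]

lemma essNorm_le_norm (x : X) : essNorm Ω x ≤ ‖x‖ :=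
  (ciInf_le (bddBelow_iSup_fibreNorm x) ⟨Set.univ, isOpen_univ, dense_univ⟩).trans
    (Real.iSup_le (fun _ => fibreNorm_le x _) (norm_nonneg x))

lemma norm_toEss (x : X) : ‖toEss Ω X x‖ = essNorm Ω x :=
  (UniformSpace.Completion.norm_coe _).trans (SeparationQuotient.norm_mk _)

lemma isometry_toEss_iff : Isometry (toEss Ω X) ↔ ∀ x : X, essNorm Ω x = ‖x‖ := by
  refine ⟨fun h x => ?_, fun h => AddMonoidHomClass.isometry_of_norm _ fun x => ?_⟩
  · rw [← norm_toEss, h.norm_map_of_map_zero (map_zero _)]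
  · rw [norm_toEss, h]

/-- The range of `X → X_ess` is dense, and complete if the map is isometric. -/
lemma surjective_toEss [CompleteSpace X] (h : Isometry (toEss Ω X)) :
    Function.Surjective (toEss Ω X) := by
  have hd : DenseRange (fun x : EssPre Ω X =>
      ((SeparationQuotient.mk x : SeparationQuotient (EssPre Ω X)) : Ess Ω X)) :=
    UniformSpace.Completion.denseRange_coe.comp
      SeparationQuotient.surjective_mk.denseRange (UniformSpace.Completion.continuous_coe _)
  rw [← Set.range_eq_univ, ← h.isClosedEmbedding.isClosed_range.closure_eq]
  exact hd.closure_range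

/-- The pointwise norm of `x` vanishes at `ω` on `fibreKernel X ω`, so it is dominated by the
quotient norm. -/
lemma PointwiseNorm.le_fibreNorm (N : PointwiseNorm Ω X) (x : X) (ω : Ω) :
    N x ω ≤ fibreNorm x ω := by
  have hzero : ∀ k ∈ fibreKernel X ω, N k ω = 0 := by
    intro k hk
    have hcl : IsClosed {k : X | N k ω = 0} :=
      isClosed_eq ((ContinuousMap.evalCLM ℝ ω).continuous.comp N.continuous) continuous_const
    refine closure_minimal (fun k hk => ?_) hcl hk
    induction (hk : k ∈ vanishingIdeal ω • (⊤ : Submodule C(Ω, ℂ) X))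
      using Submodule.smul_induction_on' with
    | smul f hf y _ =>
      refine le_antisymm ?_ (N.nonneg _ _)
      simpa [show f ω = 0 from hf] using N.smul_le f y ω
    | add y hy z hz h₁ h₂ =>
      refine le_antisymm ((N.add_le y z ω).trans_eq ?_) (N.nonneg _ _)
      rw [show N y ω = 0 from h₁, show N z ω = 0 from h₂, add_zero]
  refine le_of_forall_gt_imp_ge_of_dense fun r hr => ?_
  obtain ⟨k, hk, hxk⟩ := exists_mem_fibreKernel_norm_add_lt hr
  rw [← N.eq_of_sub_eq_zero (x := x + k) (y := x) (ω := ω) (by simpa using hzero k hk)]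
  exact (N.apply_le_norm _ ω).trans hxk.le

/-- A pointwise norm bounds the fibre norms from below, and by continuity its supremum over a dense
set is the norm of `X`. -/
theorem PointwiseNorm.isometry_toEss (N : PointwiseNorm Ω X) : Isometry (toEss Ω X) := by
  refine isometry_toEss_iff.2 fun x => le_antisymm (essNorm_le_norm x) ?_
  refine le_ciInf fun Δ => ?_
  rw [← N.norm_eq]
  refine (ContinuousMap.norm_le _ (iSup_fibreNorm_nonneg x _)).2 fun ω => ?_
  rw [Real.norm_of_nonneg (N.nonneg x ω)]
  have hcl : IsClosed {ω | N x ω ≤ ⨆ a : Δ.1, fibreNorm x a.1} :=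
    isClosed_le (N x).continuous continuous_const
  refine closure_minimal (fun a ha => ?_) hcl (Δ.2.2 ω)
  exact (N.le_fibreNorm x a).trans (le_ciSup (bddAbove_fibreNorm x Δ.1) ⟨a, ha⟩)

omit [CompactSpace Ω] in
/-- On an extremally disconnected space the closures of two open sets meet in the closure of
their intersection. -/
lemma mem_closure_inter_of_isOpen [ExtremallyDisconnected Ω] {U V : Set Ω} (hU : IsOpen U)
    (hV : IsOpen V) {ω : Ω} (h₁ : ω ∈ closure U) (h₂ : ω ∈ closure V) : ω ∈ closure (U ∩ V) := by
  have h : ω ∈ closure (U ∩ closure V) :=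
    closure_mono (by rw [Set.inter_comm])
      ((ExtremallyDisconnected.open_closure V hV).inter_closure ⟨h₂, h₁⟩)
  exact closure_minimal hU.inter_closure isClosed_closure h

/-- If the essential norm is the norm, the lower regularizations of the upper semicontinuous
functions `ω ↦ ‖x(ω)‖` form a pointwise norm. Its supremum is not smaller than `‖x‖ₑ`: where the
regularization is below `r`, the open set `{ω | ‖x(ω)‖ < r}` is dense. -/
theorem exists_pointwiseNorm_of_essNorm [ExtremallyDisconnected Ω]
    (h : ∀ x : X, essNorm Ω x = ‖x‖) : Nonempty (PointwiseNorm Ω X) := by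
  have hex : ∀ x : X, ∃ g : C(Ω, ℝ), ∀ (ω : Ω) (r : ℝ),
      (g ω < r → ω ∈ closure {a | fibreNorm x a < r}) ∧
      (ω ∈ closure {a | fibreNorm x a < r} → g ω ≤ r) := fun x =>
    exists_lowerRegularization (upperSemicontinuous_fibreNorm x) (fibreNorm_nonneg x)
      (fibreNorm_le x)
  choose g hg using hex
  have hopen : ∀ (x : X) (r : ℝ), IsOpen {a : Ω | fibreNorm x a < r} := fun x r =>
    upperSemicontinuous_iff_isOpen_preimage.1 (upperSemicontinuous_fibreNorm x) r
  have hle : ∀ x ω, g x ω ≤ fibreNorm x ω := fun x ω =>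
    le_of_forall_gt_imp_ge_of_dense fun r hr => (hg x ω r).2 (subset_closure hr)
  have hnonneg : ∀ x ω, 0 ≤ g x ω := fun x ω => by
    by_contra! hlt
    obtain ⟨a, ha⟩ := closure_nonempty_iff.1 ⟨ω, (hg x ω 0).1 hlt⟩
    exact (fibreNorm_nonneg x a).not_gt ha
  refine ⟨⟨g, fun x y ω => ?_, fun f x ω => ?_, fun x => le_antisymm ?_ ?_⟩⟩
  · refine le_of_forall_pos_le_add fun ε hε => ?_
    have hω := mem_closure_inter_of_isOpen (hopen x _) (hopen y _)
      ((hg x ω (g x ω + ε / 2)).1 (by linarith)) ((hg y ω (g y ω + ε / 2)).1 (by linarith))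
    refine (hg (x + y) ω _).2 (closure_mono (fun a ha => ?_) hω)
    have h₁ : fibreNorm x a < _ := ha.1
    have h₂ : fibreNorm y a < _ := ha.2
    show fibreNorm (x + y) a < _
    linarith [fibreNorm_add_le x y a]
  · have key : ∀ ε : ℝ, 0 < ε → g (f • x) ω ≤ (‖f ω‖ + ε) * (g x ω + ε) := fun ε hε => by
      have hfo : IsOpen {a | ‖f a‖ < ‖f ω‖ + ε} :=
        isOpen_lt f.continuous.norm continuous_const
      have hω := mem_closure_inter_of_isOpen (hopen x _) hfo
        ((hg x ω (g x ω + ε)).1 (by linarith))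
        (subset_closure (show ‖f ω‖ < ‖f ω‖ + ε by linarith))
      refine (hg (f • x) ω _).2 (closure_mono (fun a ha => ?_) hω)
      exact (fibreNorm_smul_le_apply f x a).trans_lt
        (mul_lt_mul'' ha.2 ha.1 (norm_nonneg _) (fibreNorm_nonneg x a))
    have hlim : Filter.Tendsto (fun ε : ℝ => (‖f ω‖ + ε) * (g x ω + ε))
        (nhdsWithin 0 (Set.Ioi 0)) (nhds (‖f ω‖ * g x ω)) := by
      have hc : Continuous fun ε : ℝ => (‖f ω‖ + ε) * (g x ω + ε) := by fun_prop
      simpa using (hc.tendsto 0).mono_left nhdsWithin_le_nhds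
    exact ge_of_tendsto hlim (Filter.eventually_of_mem self_mem_nhdsWithin fun ε hε => key ε hε)
  · refine (ContinuousMap.norm_le _ (norm_nonneg _)).2 fun ω => ?_
    rw [Real.norm_of_nonneg (hnonneg x ω)]
    exact (hle x ω).trans (fibreNorm_le x ω)
  · rw [← h]
    refine le_of_forall_gt_imp_ge_of_dense fun r hr => ?_
    have hd : Dense {a : Ω | fibreNorm x a < r} := fun ω =>
      (hg x ω r).1 (((le_abs_self _).trans ((g x).norm_coe_le_norm ω)).trans_lt hr)
    refine (ciInf_le (bddBelow_iSup_fibreNorm x) ⟨_, hopen x r, hd⟩).trans ?_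
    exact Real.iSup_le (fun a => le_of_lt a.2) ((norm_nonneg _).trans hr.le)

end Ess

/-! ### Pointwise norms and regularity -/

variable [NormedSpace ℂ X] [IsScalarTower ℂ C(Ω, ℂ) X]

omit [IsScalarTower ℂ C(Ω, ℂ) X] in
lemma isRegular_iff : IsRegular Ω X ↔ ∀ x : X, ‖(kappa Ω X x).1‖ = ‖x‖ := by
  have hsub : ∀ x y : X, (kappa Ω X x).1 - (kappa Ω X y).1 = (kappa Ω X (x - y)).1 :=
    fun x y => ContinuousLinearMap.ext fun φ => (φ.1.map_sub x y).symm
  refine ⟨fun h x => ?_, fun h => Isometry.of_dist_eq fun x y => ?_⟩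
  · have hd := Isometry.dist_eq h x 0
    rwa [Subtype.dist_eq, dist_eq_norm, hsub, sub_zero, dist_zero_right] at hd
  · rw [Subtype.dist_eq, dist_eq_norm, hsub, h, dist_eq_norm]

omit [IsScalarTower ℂ C(Ω, ℂ) X] in
lemma norm_kappa_le (x : X) : ‖(kappa Ω X x).1‖ ≤ ‖x‖ := by
  refine ContinuousLinearMap.opNorm_le_bound _ (norm_nonneg _) fun φ => ?_
  rw [mul_comm]
  exact φ.1.le_opNorm x

omit [IsScalarTower ℂ C(Ω, ℂ) X] in
/-- If `X` is regular, the suprema in `C(Ω, ℝ)` of the functions `|φ x|`, with `φ` in the unit ball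
of the regular dual, form a pointwise norm. -/
theorem exists_pointwiseNorm_of_isRegular [ExtremallyDisconnected Ω] (h : IsRegular Ω X) :
    Nonempty (PointwiseNorm Ω X) := by
  let D : X → Set C(Ω, ℝ) := fun x =>
    {g | ∃ φ : RegularDual Ω X, ‖φ‖ ≤ 1 ∧ ∀ ω, g ω = ‖φ.1 x ω‖}
  have hmem : ∀ x (φ : RegularDual Ω X), ‖φ‖ ≤ 1 →
      (⟨fun ω => ‖φ.1 x ω‖, (φ.1 x).continuous.norm⟩ : C(Ω, ℝ)) ∈ D x :=
    fun x φ hφ => ⟨φ, hφ, fun _ => rfl⟩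
  have hbdd : ∀ x, ContinuousMap.const Ω ‖x‖ ∈ upperBounds (D x) := by
    rintro x g ⟨φ, hφ, hg⟩ ω
    refine (hg ω).trans_le ?_
    exact ((φ.1 x).norm_coe_le_norm ω).trans ((φ.1.le_of_opNorm_le hφ x).trans_eq (one_mul _))
  have hex : ∀ x, ∃ g, IsLUB (D x) g := fun x =>
    exists_isLUB _ ⟨_, hmem x 0 (by simp)⟩ ⟨_, hbdd x⟩
  choose N hN using hex
  have hφN : ∀ x (φ : RegularDual Ω X), ‖φ‖ ≤ 1 → ∀ ω, ‖φ.1 x ω‖ ≤ N x ω :=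
    fun x φ hφ ω => (hN x).1 (hmem x φ hφ) ω
  have hnonneg : ∀ x ω, 0 ≤ N x ω := fun x ω =>
    (norm_nonneg _).trans (hφN x 0 (by simp) ω)
  have hnorm : ∀ x, ‖N x‖ ≤ ‖x‖ := fun x => by
    refine (ContinuousMap.norm_le _ (norm_nonneg _)).2 fun ω => ?_
    rw [Real.norm_of_nonneg (hnonneg x ω)]
    exact (hN x).2 (hbdd x) ω
  refine ⟨⟨N, fun x y ω => ?_, fun f x ω => ?_, fun x => le_antisymm (hnorm x) ?_⟩⟩
  · have hub : N x + N y ∈ upperBounds (D (x + y)) := by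
      rintro g ⟨φ, hφ, hg⟩ a
      refine (hg a).trans_le ?_
      rw [map_add]
      exact (norm_add_le _ _).trans (add_le_add (hφN x φ hφ a) (hφN y φ hφ a))
    exact (hN (x + y)).2 hub ω
  · have hub : (⟨fun a => ‖f a‖ * N x a, by fun_prop⟩ : C(Ω, ℝ)) ∈ upperBounds (D (f • x)) := by
      rintro g ⟨φ, hφ, hg⟩ a
      refine (hg a).trans_le ?_
      rw [φ.2 f x]
      exact (norm_mul_le _ _).trans (mul_le_mul_of_nonneg_left (hφN x φ hφ a) (norm_nonneg _))
    exact (hN (f • x)).2 hub ω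
  · rw [← isRegular_iff.1 h x]
    refine ContinuousLinearMap.opNorm_le_of_unit_norm (norm_nonneg _) fun φ hφ => ?_
    refine (ContinuousMap.norm_le _ (norm_nonneg _)).2 fun ω => ?_
    exact (hφN x φ hφ.le ω).trans ((le_abs_self _).trans ((N x).norm_coe_le_norm ω))

/-- Hahn–Banach for module maps: a pointwise norm is attained by module maps into `C(Ω)`. An
`ℂ`-linear map into `C(Ω)` dominated by a pointwise norm is a module map, because `f • x - f ω • x`
has norm zero at `ω`. -/
theorem PointwiseNorm.exists_regularDual [ExtremallyDisconnected Ω] (N : PointwiseNorm Ω X)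
    (x₀ : X) : ∃ φ : RegularDual Ω X, ‖φ‖ ≤ 1 ∧ ∀ ω, N x₀ ω ≤ ‖φ.1 x₀ ω‖ := by
  have hsub : IsSublinear (E := X) fun x => N x :=
    ⟨fun x y ω => N.add_le x y ω, fun t ht x ω => by
      have h := N.map_smul (t : ℂ) x ω
      rw [Complex.coe_smul, Complex.norm_real, Real.norm_of_nonneg ht.le] at h
      exact h.le⟩
  obtain ⟨T, hT, hTx⟩ := hsub.exists_linearMap_le exists_isGLB x₀
  let L : Ω → X →ₗ[ℂ] ℂ := fun ω =>
    Module.Dual.extendRCLike (𝕜 := ℂ) ((ContinuousMap.evalCLM ℝ ω).toLinearMap ∘ₗ T)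
  have hLapp : ∀ ω x, L ω x = (T x ω : ℂ) - Complex.I * (T (Complex.I • x) ω : ℂ) :=
    fun ω x => Module.Dual.extendRCLike_apply _ x
  have hre : ∀ ω x, (L ω x).re = T x ω := fun ω x => by simp [hLapp]
  -- Rotate `L ω x` to a nonnegative real number.
  have hbound : ∀ ω x, ‖L ω x‖ ≤ N x ω := fun ω x => by
    obtain ⟨c, hc, hcL⟩ : ∃ c : ℂ, ‖c‖ = 1 ∧ c * L ω x = ‖L ω x‖ := by
      obtain ⟨c, hc, h⟩ := RCLike.exists_norm_eq_mul_self (L ω x)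
      exact ⟨c, hc, h.symm⟩
    have h := hre ω (c • x)
    rw [LinearMap.map_smul, smul_eq_mul, hcL, Complex.ofReal_re] at h
    rw [h]
    refine (hT (c • x) ω).trans_eq ((N.map_smul c x ω).trans ?_)
    rw [hc, one_mul]
  let φ₀ : X →ₗ[ℂ] C(Ω, ℂ) :=
    { toFun := fun x => ⟨fun ω => L ω x, by
        simp only [hLapp]
        fun_prop⟩
      map_add' := fun x y => by ext ω; simp
      map_smul' := fun c x => by ext ω; simp }
  have hφ₀ : ∀ x, ‖φ₀ x‖ ≤ 1 * ‖x‖ := fun x => by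
    rw [one_mul]
    exact (ContinuousMap.norm_le _ (norm_nonneg _)).2 fun ω =>
      (hbound ω x).trans (N.apply_le_norm x ω)
  refine ⟨⟨φ₀.mkContinuous 1 hφ₀, fun f x => ?_⟩, φ₀.mkContinuous_norm_le zero_le_one hφ₀,
    fun ω => ?_⟩
  · ext ω
    show L ω (f • x) = f ω * L ω x
    have h := hbound ω (f • x - f ω • x)
    rw [N.smul_sub_smul_eq_zero, map_sub, LinearMap.map_smul, smul_eq_mul] at h
    exact sub_eq_zero.1 (norm_le_zero_iff.1 h)
  · rw [← hTx, ← hre]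
    exact Complex.re_le_norm _

theorem PointwiseNorm.isRegular [ExtremallyDisconnected Ω] (N : PointwiseNorm Ω X) :
    IsRegular Ω X := by
  refine isRegular_iff.2 fun x => le_antisymm (norm_kappa_le x) ?_
  obtain ⟨φ, hφ, hx⟩ := N.exists_regularDual x
  calc ‖x‖ = ‖N x‖ := (N.norm_eq x).symm
    _ ≤ ‖φ.1 x‖ := (ContinuousMap.norm_le _ (norm_nonneg _)).2 fun ω => by
        rw [Real.norm_of_nonneg (N.nonneg x ω)]
        exact (hx ω).trans ((φ.1 x).norm_coe_le_norm ω)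
    _ ≤ ‖(kappa Ω X x).1‖ * ‖φ‖ := (kappa Ω X x).1.le_opNorm φ
    _ ≤ ‖(kappa Ω X x).1‖ := mul_le_of_le_one_right (norm_nonneg _) hφ

end PointwiseNorm

/-! ### The (F)-Banach bundle of a pointwise norm -/

/-- A real function `f` is continuous if for every point `z` and every `ε` there are continuous
`g` and `d` with `|f - g| ≤ d` and `d z < ε`. -/
lemma continuous_of_forall_approx {Z : Type*} [TopologicalSpace Z] {f : Z → ℝ}
    (h : ∀ z, ∀ ε > 0, ∃ g d : Z → ℝ, Continuous g ∧ Continuous d ∧ d z < ε ∧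
      ∀ a, |f a - g a| ≤ d a) : Continuous f := by
  refine continuous_iff_continuousAt.2 fun z => Metric.continuousAt_iff'.2 fun ε hε => ?_
  obtain ⟨g, d, hg, hd, hdz, hfg⟩ := h z (ε / 3) (by positivity)
  filter_upwards [hd.continuousAt.eventually_lt continuousAt_const hdz,
    Metric.continuousAt_iff'.1 hg.continuousAt (ε / 3) (by positivity)] with a h₁ h₂
  rw [Real.dist_eq] at h₂ ⊢
  have h₃ := abs_lt.1 h₂
  have h₄ := abs_le.1 (hfg a)
  have h₅ := abs_le.1 (hfg z)
  exact abs_lt.2 ⟨by linarith, by linarith⟩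

namespace PointwiseNorm

variable {Ω : Type u} [TopologicalSpace Ω] [CompactSpace Ω]
variable {X : Type v} [NormedAddCommGroup X] [Module C(Ω, ℂ) X]

/-- The module `X`, to be equipped with the seminorm `x ↦ N x ω`. -/
def FibrePre (_N : PointwiseNorm Ω X) (_ω : Ω) : Type v := X

variable (N : PointwiseNorm Ω X) (ω : Ω)

instance : AddCommGroup (N.FibrePre ω) := inferInstanceAs (AddCommGroup X)

/-- `x ↦ N x ω` as a seminorm on the additive group `X`. -/
def fibreSeminorm : AddGroupSeminorm (N.FibrePre ω) where
  toFun x := N (show X from x) ω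
  map_zero' := N.map_zero ω
  add_le' x y := N.add_le x y ω
  neg' x := N.map_neg x ω

instance : SeminormedAddCommGroup (N.FibrePre ω) :=
  (N.fibreSeminorm ω).toSeminormedAddCommGroup

variable [NormedSpace ℂ X] [IsScalarTower ℂ C(Ω, ℂ) X]

instance : Module ℂ (N.FibrePre ω) := inferInstanceAs (Module ℂ X)

instance : NormedSpace ℂ (N.FibrePre ω) where
  norm_smul_le c x := (N.map_smul c (show X from x) ω).le

/-- The fibre at `ω`: the Hausdorff completion of `X` for the seminorm `x ↦ N x ω`. -/
abbrev Fibre (N : PointwiseNorm Ω X) (ω : Ω) : Type v := UniformSpace.Completion (N.FibrePre ω)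

/-- The value at `ω` of `x`, an element of the fibre. -/
def value : X →ₗ[ℂ] N.Fibre ω where
  toFun x := ((show N.FibrePre ω from x) : N.Fibre ω)
  map_add' x y := UniformSpace.Completion.coe_add (show N.FibrePre ω from x) y
  map_smul' c x := UniformSpace.Completion.coe_smul c (show N.FibrePre ω from x)

lemma norm_value (x : X) : ‖N.value ω x‖ = N x ω :=
  UniformSpace.Completion.norm_coe (show N.FibrePre ω from x)

lemma norm_value_sub_value (x y : X) : ‖N.value ω x - N.value ω y‖ = N (x - y) ω := by
  rw [← map_sub, norm_value]

lemma denseRange_value : DenseRange (N.value ω) :=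
  UniformSpace.Completion.denseRange_coe (α := N.FibrePre ω)

lemma exists_norm_sub_value_lt (v : N.Fibre ω) {ε : ℝ} (hε : 0 < ε) :
    ∃ x, ‖v - N.value ω x‖ < ε := by
  obtain ⟨x, hx⟩ := Metric.denseRange_iff.1 (N.denseRange_value ω) v ε hε
  exact ⟨x, by rwa [← dist_eq_norm]⟩

lemma value_smul (f : C(Ω, ℂ)) (x : X) : N.value ω (f • x) = f ω • N.value ω x := by
  rw [← sub_eq_zero, ← map_smul, ← map_sub, ← norm_eq_zero, norm_value]
  exact N.smul_sub_smul_eq_zero f x ω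

variable {N}

/-- The distance from a point of the bundle to the section given by `x`. -/
def distTo (x : X) (e : Total N.Fibre) : ℝ := ‖e.point - N.value e.proj x‖

/-- The coarsest topology for which the projection and the distances to the sections given by the
elements of `X` are continuous. -/
instance : TopologicalSpace (Total N.Fibre) :=
  TopologicalSpace.induced (fun e => (e.proj, fun x => distTo x e))
    (inferInstance : TopologicalSpace (Ω × (X → ℝ)))

lemma continuous_total_iff {Z : Type*} [TopologicalSpace Z] {F : Z → Total N.Fibre} :
    Continuous F ↔ Continuous (fun z => (F z).proj) ∧ ∀ x, Continuous fun z => distTo x (F z) := by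
  exact continuous_induced_rng.trans (continuous_prodMk.trans (and_congr_right' continuous_pi_iff))

lemma continuous_total_proj : Continuous (Total.proj : Total N.Fibre → Ω) :=
  (continuous_total_iff.1 continuous_id).1

lemma continuous_distTo (x : X) : Continuous (distTo x : Total N.Fibre → ℝ) :=
  (continuous_total_iff.1 continuous_id).2 x

lemma continuous_total_norm : Continuous fun e : Total N.Fibre => ‖e.point‖ := by
  have h : Continuous fun e : Total N.Fibre => ‖e.point - N.value e.proj 0‖ := continuous_distTo 0
  simpa using h

lemma continuous_value (x : X) : Continuous fun ω => (⟨ω, N.value ω x⟩ : Total N.Fibre) := by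
  refine continuous_total_iff.2 ⟨continuous_id, fun y => ?_⟩
  simp only [distTo, norm_value_sub_value]
  exact (N (x - y)).continuous

lemma continuous_mk : Continuous fun v : N.Fibre ω => (⟨ω, v⟩ : Total N.Fibre) :=
  continuous_total_iff.2 ⟨continuous_const, fun x =>
    show Continuous fun v : N.Fibre ω => ‖v - N.value ω x‖ by fun_prop⟩

/-- Every nonempty open subset of the total space is met by a section given by an element of `X`. -/
lemma isOpenMap_total_proj : IsOpenMap (Total.proj : Total N.Fibre → Ω) := by
  intro S hS
  refine isOpen_iff_mem_nhds.2 ?_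
  rintro _ ⟨⟨ω, v⟩, hv, rfl⟩
  obtain ⟨x, hx⟩ := (N.denseRange_value ω).exists_mem_open (hS.preimage (continuous_mk ω)) ⟨v, hv⟩
  filter_upwards [(continuous_value x).continuousAt.preimage_mem_nhds (hS.mem_nhds hx)] with a ha
  exact ⟨_, ha, rfl⟩

lemma continuous_total_add :
    @Continuous (Total fun ω => N.Fibre ω × N.Fibre ω) (Total N.Fibre)
      (TopologicalSpace.induced (fun q => ((⟨q.proj, q.point.1⟩ : Total N.Fibre),
        (⟨q.proj, q.point.2⟩ : Total N.Fibre))) inferInstance) inferInstance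
      (fun q => ⟨q.proj, q.point.1 + q.point.2⟩) := by
  let _ : TopologicalSpace (Total fun ω => N.Fibre ω × N.Fibre ω) :=
    TopologicalSpace.induced (fun q => ((⟨q.proj, q.point.1⟩ : Total N.Fibre),
        (⟨q.proj, q.point.2⟩ : Total N.Fibre))) inferInstance
  have hpair : Continuous fun q : Total fun ω => N.Fibre ω × N.Fibre ω =>
      ((⟨q.proj, q.point.1⟩ : Total N.Fibre), (⟨q.proj, q.point.2⟩ : Total N.Fibre)) :=
    continuous_induced_dom
  have hproj : Continuous fun q : Total fun ω => N.Fibre ω × N.Fibre ω => q.proj :=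
    continuous_total_proj.comp (continuous_fst.comp hpair)
  refine continuous_total_iff.2 ⟨hproj, fun x => continuous_of_forall_approx fun q ε hε => ?_⟩
  obtain ⟨y, hy⟩ := N.exists_norm_sub_value_lt q.proj q.point.1 (half_pos hε)
  obtain ⟨z, hz⟩ := N.exists_norm_sub_value_lt q.proj q.point.2 (half_pos hε)
  refine ⟨fun a => N (y + z - x) a.proj,
    fun a => distTo y (⟨a.proj, a.point.1⟩ : Total N.Fibre) +
      distTo z (⟨a.proj, a.point.2⟩ : Total N.Fibre),
    (N _).continuous.comp hproj,
    ((continuous_distTo y).comp (continuous_fst.comp hpair)).add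
      ((continuous_distTo z).comp (continuous_snd.comp hpair)),
    by simp only [distTo]; linarith, fun a => ?_⟩
  simp only [distTo]
  rw [← norm_value_sub_value, map_add]
  refine (abs_norm_sub_norm_le _ _).trans ?_
  rw [sub_sub_sub_cancel_right, add_sub_add_comm]
  exact norm_add_le _ _

lemma continuous_total_smul :
    Continuous fun q : ℂ × Total N.Fibre => (⟨q.2.proj, q.1 • q.2.point⟩ : Total N.Fibre) := by
  have hproj : Continuous fun q : ℂ × Total N.Fibre => q.2.proj :=
    continuous_total_proj.comp continuous_snd
  refine continuous_total_iff.2 ⟨hproj, fun x => continuous_of_forall_approx fun q ε hε => ?_⟩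
  obtain ⟨y, hy⟩ := N.exists_norm_sub_value_lt q.2.proj q.2.point
    (show 0 < ε / (‖q.1‖ + 1) by positivity)
  refine ⟨fun a => N (a.1 • y - x) a.2.proj, fun a => ‖a.1‖ * distTo y a.2, ?_,
    continuous_fst.norm.mul ((continuous_distTo y).comp continuous_snd), ?_, fun a => ?_⟩
  · have hN : Continuous fun a : ℂ × Total N.Fibre => N (a.1 • y - x) :=
      N.continuous.comp (by fun_prop)
    exact continuous_eval.comp (hN.prodMk hproj)
  · rw [lt_div_iff₀ (by positivity)] at hy
    have h₀ := norm_nonneg (q.2.point - N.value q.2.proj y)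
    simp only [distTo]
    nlinarith
  · simp only [distTo]
    rw [← norm_value_sub_value, map_smul, ← norm_smul]
    refine (abs_norm_sub_norm_le _ _).trans ?_
    rw [sub_sub_sub_cancel_right, smul_sub]

lemma nhds_total_zero : nhds (⟨ω, 0⟩ : Total N.Fibre) =
    Filter.comap (fun e : Total N.Fibre => (e.proj, ‖e.point‖)) (nhds (ω, 0)) := by
  refine le_antisymm ?_ ?_
  · refine Filter.tendsto_iff_comap.1 ?_
    have h : Continuous fun e : Total N.Fibre => (e.proj, ‖e.point‖) :=
      continuous_total_proj.prodMk continuous_total_norm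
    simpa using h.tendsto (⟨ω, 0⟩ : Total N.Fibre)
  · rw [nhds_induced, ← Filter.tendsto_iff_comap, nhds_prod_eq, nhds_prod_eq]
    have hproj : Filter.Tendsto (fun e : Total N.Fibre => e.proj)
        (Filter.comap (fun e : Total N.Fibre => (e.proj, ‖e.point‖)) (nhds ω ×ˢ nhds 0))
        (nhds ω) := Filter.tendsto_fst.comp Filter.tendsto_comap
    have hnorm : Filter.Tendsto (fun e : Total N.Fibre => ‖e.point‖)
        (Filter.comap (fun e : Total N.Fibre => (e.proj, ‖e.point‖)) (nhds ω ×ˢ nhds 0))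
        (nhds 0) := Filter.tendsto_snd.comp Filter.tendsto_comap
    set l := Filter.comap (fun e : Total N.Fibre => (e.proj, ‖e.point‖)) (nhds ω ×ˢ nhds 0)
    refine hproj.prodMk (tendsto_pi_nhds.2 fun x => ?_)
    -- In a tube around zero the distance to `x` is close to the norm of `x`.
    have h₁ : Filter.Tendsto (fun e : Total N.Fibre => N x e.proj) l (nhds (N x ω)) :=
      ((N x).continuous.tendsto ω).comp hproj
    have h₂ : Filter.Tendsto (fun e : Total N.Fibre => distTo x e - N x e.proj) l (nhds 0) := by
      refine squeeze_zero_norm (fun e => ?_) hnorm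
      rw [← norm_value, ← norm_neg (N.value e.proj x), distTo]
      refine (abs_norm_sub_norm_le _ _).trans_eq ?_
      rw [sub_neg_eq_add, sub_add_cancel]
    have h₃ := h₂.add h₁
    simpa [distTo, norm_value] using h₃

lemma nhds_total_zero_hasBasis : (nhds (⟨ω, 0⟩ : Total N.Fibre)).HasBasis
    (fun q : Set Ω × ℝ => q.1 ∈ nhds ω ∧ 0 < q.2)
    (fun q => {e | e.proj ∈ q.1 ∧ ‖e.point‖ < q.2}) := by
  rw [nhds_total_zero, nhds_prod_eq]
  refine (((nhds ω).basis_sets.prod (Metric.nhds_basis_ball (x := (0 : ℝ)))).comap _).congr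
    (fun _ => Iff.rfl) fun q _ => ?_
  ext e
  simp

variable (N)

/-- The bundle of a pointwise norm. -/
def bundle : HBundle.{u, v} Ω where
  Fibre := N.Fibre
  continuous_proj := continuous_total_proj
  isOpenMap_proj := isOpenMap_total_proj
  continuous_add := continuous_total_add
  continuous_smul := continuous_total_smul
  upperSemicontinuous_norm := continuous_total_norm.upperSemicontinuous
  nhds_zero ω := nhds_total_zero_hasBasis ω

lemma isF_bundle : N.bundle.IsF := continuous_total_norm

/-- The canonical isometric module map from `X` to the sections of its bundle. -/
def toSections : X →ₗᵢ[C(Ω, ℂ)] N.bundle.Sections where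
  toFun x := ⟨fun ω => N.value ω x, continuous_value x⟩
  map_add' x y := HBundle.Sections.ext fun ω => map_add (N.value ω) x y
  map_smul' f x := HBundle.Sections.ext fun ω => N.value_smul ω f x
  norm_map' x := by
    rw [← N.norm_eq, ContinuousMap.norm_eq_iSup_norm]
    refine iSup_congr fun ω => ?_
    rw [Real.norm_of_nonneg (N.nonneg x ω)]
    exact N.norm_value ω x

/-- A Stone–Weierstrass argument: a continuous section is locally close to sections given by
elements of `X`, and these can be glued along clopen sets. -/
lemma exists_forall_norm_sub_value_lt [T2Space Ω] [TotallyDisconnectedSpace Ω]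
    {σ : ∀ ω, N.Fibre ω} (hσ : Continuous fun ω => (⟨ω, σ ω⟩ : Total N.Fibre)) {ε : ℝ}
    (hε : 0 < ε) : ∃ x, ∀ ω, ‖σ ω - N.value ω x‖ < ε := by
  have hs : ∀ x, Continuous fun ω => ‖σ ω - N.value ω x‖ := fun x =>
    (continuous_total_iff.1 hσ).2 x
  let p : Set Ω → Prop := fun t => ∃ x : X, ∃ K : Set Ω, IsClopen K ∧ t ⊆ K ∧
    ∀ ω ∈ K, ‖σ ω - N.value ω x‖ < ε
  have hempty : p ∅ := ⟨0, ∅, isClopen_empty, le_rfl, by simp⟩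
  have hmono : ∀ ⦃t t' : Set Ω⦄, t ⊆ t' → p t' → p t := by
    rintro t t' htt' ⟨x, K, hK, htK, hx⟩
    exact ⟨x, K, hK, htt'.trans htK, hx⟩
  have hunion : ∀ ⦃t t' : Set Ω⦄, p t → p t' → p (t ∪ t') := by
    rintro t t' ⟨x, K, hK, htK, hx⟩ ⟨x', K', hK', htK', hx'⟩
    -- The indicator function of `K` glues `x` on `K` to `x'` elsewhere.
    let f : C(Ω, ℂ) :=
      ⟨K.indicator fun _ => 1, continuous_const.indicator (by simp [hK.frontier_eq])⟩
    refine ⟨f • x + (1 - f) • x', K ∪ K', hK.union hK', Set.union_subset_union htK htK',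
      fun ω hω => ?_⟩
    rw [map_add, value_smul, value_smul]
    by_cases h : ω ∈ K
    · have hf : f ω = 1 := Set.indicator_of_mem h fun _ => (1 : ℂ)
      rw [ContinuousMap.sub_apply, hf, ContinuousMap.one_apply, sub_self, one_smul, zero_smul,
        add_zero]
      exact hx ω h
    · have hf : f ω = 0 := Set.indicator_of_notMem h fun _ => (1 : ℂ)
      rw [ContinuousMap.sub_apply, hf, ContinuousMap.one_apply, sub_zero, one_smul, zero_smul,
        zero_add]
      exact hx' ω (hω.resolve_left h)
  have hlocal : ∀ ω ∈ Set.univ, ∃ t ∈ nhdsWithin ω Set.univ, p t := by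
    intro ω _
    obtain ⟨x, hx⟩ := N.exists_norm_sub_value_lt ω (σ ω) hε
    obtain ⟨K, hK, hωK, hKs⟩ := compact_exists_isClopen_in_isOpen
      (isOpen_lt (hs x) continuous_const) (show ω ∈ {a | ‖σ a - N.value a x‖ < ε} from hx)
    exact ⟨K, mem_nhdsWithin_of_mem_nhds (hK.isOpen.mem_nhds hωK), x, K, hK, le_rfl, hKs⟩
  have key : p Set.univ := isCompact_univ.induction_on hempty hmono hunion hlocal
  obtain ⟨x, K, -, hK, hx⟩ := key
  exact ⟨x, fun ω => hx ω (hK trivial)⟩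

lemma denseRange_toSections [T2Space Ω] [TotallyDisconnectedSpace Ω] :
    DenseRange N.toSections := by
  refine Metric.denseRange_iff.2 fun s ε hε => ?_
  obtain ⟨x, hx⟩ := N.exists_forall_norm_sub_value_lt s.2 (half_pos hε)
  refine ⟨x, ?_⟩
  rw [dist_eq_norm]
  exact lt_of_le_of_lt (Real.iSup_le (fun ω => (hx ω).le) (half_pos hε).le) (half_lt_self hε)

/-- A complete `X` is the module of all sections of its bundle. -/
def equivSections [T2Space Ω] [TotallyDisconnectedSpace Ω] [CompleteSpace X] :
    X ≃ₗᵢ[C(Ω, ℂ)] N.bundle.Sections :=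
  LinearIsometryEquiv.ofSurjective N.toSections (by
    rw [← Set.range_eq_univ, ← N.toSections.isometry.isClosedEmbedding.isClosed_range.closure_eq]
    exact N.denseRange_toSections.closure_range)

end PointwiseNorm

/-- The norms of the values of the sections of an (F)-Banach bundle. -/
def PointwiseNorm.ofSections {Ω : Type u} [TopologicalSpace Ω] [CompactSpace Ω]
    {X : Type v} [NormedAddCommGroup X] [Module C(Ω, ℂ) X] {E : HBundle.{u, v} Ω} (hE : E.IsF)
    (i : X ≃ₗᵢ[C(Ω, ℂ)] E.Sections) : PointwiseNorm Ω X where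
  toFun x := ⟨fun ω => ‖(i x).1 ω‖, hE.comp (i x).2⟩
  add_le x y ω := by
    have h : (i (x + y)).1 ω = (i x).1 ω + (i y).1 ω := by
      rw [map_add]
      rfl
    exact (congrArg norm h).trans_le (norm_add_le ((i x).1 ω) ((i y).1 ω))
  smul_le f x ω := by
    have h : (i (f • x)).1 ω = f ω • (i x).1 ω := by
      rw [map_smul]
      rfl
    exact (congrArg norm h).trans_le (norm_smul_le (f ω) ((i x).1 ω))
  norm_eq x := by
    rw [ContinuousMap.norm_eq_iSup_norm, ← i.norm_map]
    exact iSup_congr fun ω => norm_norm ((i x).1 ω)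

end
end BanachModule

theorem mainTheorem3
    {Ω : Type u} [TopologicalSpace Ω] [CompactSpace Ω] [T2Space Ω]
    [MeasurableSpace Ω] [BorelSpace Ω] (hΩ : BanachModule.IsHyperStonian Ω)
    {X : Type v} [NormedAddCommGroup X] [NormedSpace ℂ X] [CompleteSpace X]
    [Module C(Ω, ℂ) X] [IsScalarTower ℂ C(Ω, ℂ) X] [IsBoundedSMul C(Ω, ℂ) X]
    (hX : BanachModule.IsCConvex Ω X) :
    List.TFAE [
      Isometry (BanachModule.toEss Ω X) ∧ Function.Surjective (BanachModule.toEss Ω X),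
      BanachModule.IsRegular Ω X,
      ∃ E : BanachModule.HBundle.{u, v} Ω, E.IsF ∧ Nonempty (X ≃ₗᵢ[C(Ω, ℂ)] E.Sections)] := by
  have := hΩ.stonian
  have h₁ : Isometry (BanachModule.toEss Ω X) ∧ Function.Surjective (BanachModule.toEss Ω X) ↔
      Nonempty (BanachModule.PointwiseNorm Ω X) :=
    ⟨fun h => BanachModule.exists_pointwiseNorm_of_essNorm
      (BanachModule.isometry_toEss_iff.1 h.1),
      fun ⟨N⟩ => ⟨N.isometry_toEss, BanachModule.surjective_toEss N.isometry_toEss⟩⟩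
  have h₂ : BanachModule.IsRegular Ω X ↔ Nonempty (BanachModule.PointwiseNorm Ω X) :=
    ⟨BanachModule.exists_pointwiseNorm_of_isRegular, fun ⟨N⟩ => N.isRegular⟩
  have h₃ : (∃ E : BanachModule.HBundle.{u, v} Ω, E.IsF ∧
      Nonempty (X ≃ₗᵢ[C(Ω, ℂ)] E.Sections)) ↔ Nonempty (BanachModule.PointwiseNorm Ω X) :=
    ⟨fun ⟨_, hE, ⟨i⟩⟩ => ⟨BanachModule.PointwiseNorm.ofSections hE i⟩,
      fun ⟨N⟩ => ⟨N.bundle, N.isF_bundle, ⟨N.equivSections⟩⟩⟩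
  tfae_have 1 ↔ 2 := h₁.trans h₂.symm
  tfae_have 2 ↔ 3 := h₂.trans h₃.symm
  tfae_finish
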